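/- Let $n$ be a positive integer and let $X_n=\mathrm{Cay}(\mathbb{Z}_n,U(n))$ be the unitary Cayley graph, that is, the simple graph with vertex set $\mathbb{Z}_n=\mathbb{Z}/n\mathbb{Z}$ in which two distinct vertices $a,b$ are adjacent if and only if $a-b\in U(n)$, where $U(n)=\{u : 1\le u\le n-1,\ \gcd(u,n)=1\}$ is viewed inside $\mathbb{Z}_n$. For a finite simple graph $\Gamma$ with adjacency matrix $A$, put $H(t)=\exp(-\mathbf{i}tA)$ for $t\in\mathbb{R}$, where $\mathbf{i}=\sqrt{-1}$, and let $\mathbf{e}_a$ be the standard basis vector of the vertex $a$. The graph $\Gamma$ admits pretty good fractional revival if there are two distinct vertices $a,b$, a sequence $(t_k)$ of real numbers, and complex numbers $\alpha,\beta$ with $\beta\neq 0$ and $|\alpha|^2+|\beta|^2=1$ such that $$\lim_{k\to\infty}H(t_k)\mathbf{e}_a=\alpha\,\mathbf{e}_a+\beta\,\mathbf{e}_b.$$ **Theorem.** The graph $X_n$ admits pretty good fractional revival if and only if $n=2$ or $n=2p$ for some prime $p$. -/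

import Mathlib

/-- The column vector `e_a` indexed by the vertices: `1` in position `a` and `0` elsewhere. -/
noncomputable def vertexVec {V : Type*} [DecidableEq V] (a : V) : V → ℂ := Pi.single a 1

open Classical in
/-- The transition matrix `H(t) = exp(-i t A)` of a finite simple graph with adjacency
matrix `A`. -/
noncomputable def transitionMatrix {V : Type*} [Fintype V] (G : SimpleGraph V) (t : ℝ) :
    Matrix V V ℂ :=
  NormedSpace.exp ((-(Complex.I * (t : ℂ))) • G.adjMatrix ℂ)

open Classical in
/-- Pretty good fractional revival from the vertex `a` to another vertex `b`. The limit is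
that of vectors in `V → ℂ`, that is, entrywise. -/
def AdmitsPGFRFromTo {V : Type*} [Fintype V] (G : SimpleGraph V) (a b : V) : Prop :=
  a ≠ b ∧ ∃ (t : ℕ → ℝ) (α β : ℂ), β ≠ 0 ∧ ‖α‖ ^ 2 + ‖β‖ ^ 2 = 1 ∧
    Filter.Tendsto (fun k => (transitionMatrix G (t k)).mulVec (vertexVec a)) Filter.atTop
      (nhds (α • vertexVec a + β • vertexVec b))

/-- A graph admits pretty good fractional revival if it does so from some vertex to another. -/
def AdmitsPGFR {V : Type*} [Fintype V] (G : SimpleGraph V) : Prop :=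
  ∃ a b : V, AdmitsPGFRFromTo G a b

/-- The set `U(n) = {u : 1 ≤ u ≤ n - 1, gcd(u, n) = 1}`, viewed inside `ℤ/nℤ`. -/
def unitarySet (n : ℕ) : Set (ZMod n) :=
  {x | ∃ u : ℕ, 1 ≤ u ∧ u ≤ n - 1 ∧ Nat.gcd u n = 1 ∧ (u : ZMod n) = x}

/-- The unitary Cayley graph `X_n = Cay(ℤ/nℤ, U(n))`: distinct vertices `a` and `b` are
adjacent when `a - b ∈ U(n)` (or `b - a ∈ U(n)`, which is the same as `U(n) = -U(n)`). -/
def unitaryCayleyGraph (n : ℕ) : SimpleGraph (ZMod n) :=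
  SimpleGraph.circulantGraph (unitarySet n)

/-!
The additive characters `y ↦ ψ (y * x)` of `ZMod n`, where `ψ` is the standard one, diagonalize the
unitary Cayley graph, with eigenvalues `λ x = ∑ ψ (c * x)` over the units `c` (`unitSum`). Taking
Fourier coefficients, revival from `a` to `b` along times `t k` means that
`exp (-i * t k * λ x)` tends to `f x = α + β * ψ (d * x)` for every `x`, where `d = b - a`
(`AdmitsPGFRFromTo.tendsto_exp`). Integer linear relations between eigenvalues therefore become
multiplicative relations between the values of `f`.

Necessity. Since `λ (-x) = λ x`, the element `d` has order two, so `n` is even, `d` is `n / 2`, and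
`f 1 = α - β` differs from `f 2 = α + β`. This is contradicted as follows.
* If `n` is divisible by `8` or by the square of an odd prime, then translation of the units by a
  suitable nilpotent element shows `λ 1 = λ 2 = 0` (`unitSum_eq_zero_of_isNilpotent`), so
  `f 1 = f 2 = 1`.
* If an odd prime `q` divides `n` exactly once, the Chinese remainder theorem provides `x'` with
  `d * x' = d * x` and `λ x' = -(q - 1) * λ x` (`exists_unitSum_eq_neg_pred_mul`), so that
  `f x ^ q = 1` for `x = 1, 2`.
* If `4` divides `n`, then `d * d = 0` and `λ (x + d) = -λ x` give `f x ^ 2 = 1`.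

Two coprime exponents in the last two items force `f 1 = f 2`, which leaves only `n = 2`, `n = 4`
and `n = 2 * q`.

Sufficiency. If the eigenvalue phases at a single time equal `α + β * ψ (d * x)`, injectivity of
the discrete Fourier transform gives exact revival (`admitsPGFR_of_exp_eq`). The time is `π / 2`
for `n = 2, 4`, and `2 * π / p` for `n = 2 * p` with `p` odd.
-/

/-! ### Sums of an additive character over the units -/

open Classical in
/-- The sum `∑ ψ (c * x)` over the units `c` of a finite ring. For `R = ZMod n` and the standard
character these are the Ramanujan sums, for `n ≠ 1` the eigenvalues of the unitary Cayley graph. -/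
noncomputable def unitSum {R : Type*} [CommRing R] [Fintype R] (ψ : AddChar R ℂ) (x : R) : ℂ :=
  ∑ c : R, if IsUnit c then ψ (c * x) else 0

section UnitSum

variable {R : Type*} [CommRing R] [Fintype R] (ψ : AddChar R ℂ)

theorem unitSum_unit_mul {w : R} (hw : IsUnit w) (x : R) :
    unitSum ψ (w * x) = unitSum ψ x := by
  classical
  obtain ⟨w, rfl⟩ := hw
  unfold unitSum
  refine Fintype.sum_equiv w.mulRight _ _ fun c => ?_
  simp [mul_assoc]

theorem unitSum_neg (x : R) : unitSum ψ (-x) = unitSum ψ x := by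
  have := unitSum_unit_mul ψ (isUnit_one.neg : IsUnit (-1 : R)) x
  simpa using this

/-- If `ψ` is constant on the unit multiples of `d`, translating the argument by `d` only scales
the sum. -/
theorem unitSum_add_of_forall_unit {d : R} (z : ℂ) (hd : ∀ c : R, IsUnit c → ψ (c * d) = z)
    (x : R) : unitSum ψ (x + d) = z * unitSum ψ x := by
  classical
  unfold unitSum
  rw [Finset.mul_sum]
  refine Finset.sum_congr rfl fun c _ => ?_
  split_ifs with h
  · rw [mul_add, AddChar.map_add_eq_mul, hd c h, mul_comm]
  · simp

/-- Translation by a nilpotent `s` permutes the units, which multiplies the sum by `ψ (s * x)`. -/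
theorem unitSum_eq_zero_of_isNilpotent {s : R} (hs : IsNilpotent s) {x : R} (h : ψ (s * x) ≠ 1) :
    unitSum ψ x = 0 := by
  classical
  have key : unitSum ψ x = ψ (s * x) * unitSum ψ x := by
    conv_rhs => rw [unitSum, Finset.mul_sum]
    unfold unitSum
    symm
    refine Fintype.sum_equiv (Equiv.addRight s) _ _ fun c => ?_
    have hu : IsUnit (c + s) ↔ IsUnit c := by
      refine ⟨fun h => ?_, fun h => hs.isUnit_add_left_of_commute h (Commute.all _ _)⟩
      simpa using hs.neg.isUnit_add_left_of_commute h (Commute.all _ _)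
    simp only [Equiv.coe_addRight, hu]
    split_ifs
    · rw [add_mul, AddChar.map_add_eq_mul, mul_comm]
    · simp
  by_contra h0
  exact h (mul_right_cancel₀ h0 (by rw [← key, one_mul]))

theorem unitSum_ringEquiv {S : Type*} [CommRing S] [Fintype S] (e : R ≃+* S) (x : R) :
    unitSum (ψ.compAddMonoidHom (e.symm : S →+ R)) (e x) = unitSum ψ x := by
  classical
  unfold unitSum
  symm
  refine Fintype.sum_equiv e.toEquiv _ _ fun c => ?_
  simp

end UnitSum

section Prod

variable {F B : Type*} [Field F] [Fintype F] [CommRing B] [Fintype B]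

/-- Summing over the first coordinate gives `0` by orthogonality, and all its nonzero values
contribute equally since they differ by units. -/
theorem unitSum_prod_zero_left (ψ : AddChar (F × B) ℂ) (hψ : ∃ a, ψ (a, 0) ≠ 1) {a : F}
    (ha : a ≠ 0) (b : B) :
    unitSum ψ (0, b) = -((Fintype.card F : ℂ) - 1) * unitSum ψ (a, b) := by
  classical
  have hsum : ∑ y : F, unitSum ψ (y, b) = 0 := by
    unfold unitSum
    rw [Finset.sum_comm]
    refine Finset.sum_eq_zero fun c _ => ?_
    split_ifs with hc
    · have hc1 : c.1 ≠ 0 := (Prod.isUnit_iff.1 hc).1.ne_zero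
      have h1 : ∑ y : F, ψ (c.1 * y, 0) = 0 := by
        have hne : ψ.compAddMonoidHom
            ((AddMonoidHom.inl F B).comp (AddMonoidHom.mulLeft c.1)) ≠ 1 := by
          obtain ⟨a₀, h₀⟩ := hψ
          refine AddChar.ne_one_iff.2 ⟨c.1⁻¹ * a₀, ?_⟩
          simpa [mul_inv_cancel_left₀ hc1] using h₀
        simpa using AddChar.sum_eq_zero_of_ne_one hne
      calc ∑ y : F, ψ (c * (y, b)) = ∑ y : F, ψ (c.1 * y, 0) * ψ (0, c.2 * b) := by
            refine Finset.sum_congr rfl fun y _ => ?_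
            rw [← AddChar.map_add_eq_mul]
            simp [Prod.mul_def]
        _ = 0 := by rw [← Finset.sum_mul, h1, zero_mul]
    · simp
  have hne : ∀ y ∈ Finset.univ.erase (0 : F), unitSum ψ (y, b) = unitSum ψ (a, b) := by
    intro y hy
    have hy0 := Finset.ne_of_mem_erase hy
    have hu : IsUnit ((y * a⁻¹, 1) : F × B) :=
      Prod.isUnit_iff.2 ⟨(mul_ne_zero hy0 (inv_ne_zero ha)).isUnit, isUnit_one⟩
    simpa [inv_mul_cancel_right₀ ha] using unitSum_unit_mul ψ hu (a, b)
  rw [← Finset.add_sum_erase _ _ (Finset.mem_univ (0 : F)), Finset.sum_congr rfl hne,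
    Finset.sum_const, Finset.card_erase_of_mem (Finset.mem_univ _), Finset.card_univ,
    nsmul_eq_mul, Nat.cast_sub Fintype.card_pos, Nat.cast_one] at hsum
  linear_combination hsum

end Prod

/-! ### The spectral decomposition of the transition matrix -/

section Spectral

theorem vecMul_exp_of_vecMul_eq_smul {V : Type*} [Fintype V] [DecidableEq V] {M : Matrix V V ℂ}
    {v : V → ℂ} {μ : ℂ} (h : Matrix.vecMul v M = μ • v) :
    Matrix.vecMul v (NormedSpace.exp M) = Complex.exp μ • v := by
  have hpow : ∀ k : ℕ, Matrix.vecMul v (M ^ k) = μ ^ k • v := by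
    intro k
    induction k with
    | zero => simp
    | succ k ih => rw [pow_succ, ← Matrix.vecMul_vecMul, ih, Matrix.smul_vecMul, h, smul_smul,
        pow_succ]
  open scoped Matrix.Norms.Operator in
  have h1 : HasSum (fun k : ℕ => ((k.factorial : ℂ)⁻¹) • M ^ k) (NormedSpace.exp M) :=
    NormedSpace.exp_series_hasSum_exp' M
  have h2 : HasSum (fun k : ℕ => ((k.factorial : ℂ)⁻¹) • μ ^ k) (Complex.exp μ) := by
    rw [Complex.exp_eq_exp_ℂ]
    exact NormedSpace.exp_series_hasSum_exp' μ
  let φ : Matrix V V ℂ →+ (V → ℂ) :=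
    { toFun := fun N => Matrix.vecMul v N
      map_zero' := Matrix.vecMul_zero v
      map_add' := fun N N' => Matrix.vecMul_add N N' v }
  have hc : Continuous φ := Continuous.matrix_vecMul continuous_const continuous_id
  have h3 := h1.map φ hc
  refine h3.unique ?_
  convert h2.smul_const v using 1
  funext k
  change Matrix.vecMul v (_ • M ^ k) = _
  rw [Matrix.vecMul_smul, hpow, smul_assoc]

open Classical in
theorem vecMul_transitionMatrix {V : Type*} [Fintype V] (G : SimpleGraph V) (t : ℝ) {v : V → ℂ}
    {μ : ℂ} (h : Matrix.vecMul v (G.adjMatrix ℂ) = μ • v) :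
    Matrix.vecMul v (transitionMatrix G t) = Complex.exp (-(Complex.I * t) * μ) • v := by
  refine vecMul_exp_of_vecMul_eq_smul ?_
  rw [Matrix.vecMul_smul, h, smul_smul]

/-- The case `n = 1` is excluded because `unitarySet 1` is empty, while `0` is a unit of the zero
ring. -/
theorem mem_unitarySet_iff_isUnit {n : ℕ} [NeZero n] (hn : n ≠ 1) (x : ZMod n) :
    x ∈ unitarySet n ↔ IsUnit x := by
  have hn0 := NeZero.ne n
  constructor
  · rintro ⟨u, -, -, hu, rfl⟩
    exact (ZMod.isUnit_iff_coprime u n).2 hu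
  · intro hx
    have hv : (x.val : ZMod n) = x := ZMod.natCast_zmod_val x
    have hc : x.val.Coprime n := (ZMod.isUnit_iff_coprime x.val n).1 (by rwa [hv])
    refine ⟨x.val, ?_, by have := ZMod.val_lt x; omega, hc, hv⟩
    rw [Nat.one_le_iff_ne_zero]
    intro h0
    rw [h0, Nat.coprime_zero_left] at hc
    exact hn hc

theorem unitaryCayleyGraph_adj {n : ℕ} [NeZero n] (hn : n ≠ 1) (a b : ZMod n) :
    (unitaryCayleyGraph n).Adj a b ↔ IsUnit (a - b) := by
  have : Fact (1 < n) := ⟨by have := NeZero.ne n; omega⟩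
  rw [unitaryCayleyGraph, SimpleGraph.circulantGraph_adj, mem_unitarySet_iff_isUnit hn,
    mem_unitarySet_iff_isUnit hn, ← neg_sub a b, IsUnit.neg_iff, or_self]
  refine ⟨fun h => h.2, fun h => ⟨?_, h⟩⟩
  rintro rfl
  simp at h

open Classical in
theorem vecMul_adjMatrix_unitaryCayleyGraph {n : ℕ} [NeZero n] (hn : n ≠ 1) (x : ZMod n) :
    Matrix.vecMul (fun a => ZMod.stdAddChar (a * x)) ((unitaryCayleyGraph n).adjMatrix ℂ) =
      unitSum ZMod.stdAddChar x • fun a : ZMod n => (ZMod.stdAddChar (a * x) : ℂ) := by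
  funext b
  simp only [Matrix.vecMul, dotProduct, SimpleGraph.adjMatrix_apply, unitaryCayleyGraph_adj hn,
    Pi.smul_apply, smul_eq_mul, unitSum, Finset.sum_mul]
  refine Fintype.sum_equiv (Equiv.subRight b) _ _ fun a => ?_
  simp only [Equiv.subRight_apply, mul_ite, mul_one, mul_zero, ite_mul, zero_mul]
  refine if_congr Iff.rfl ?_ rfl
  rw [← AddChar.map_add_eq_mul]
  congr 1
  ring

/-- A Fourier coefficient of the state at time `t` is that of the initial state times the phase of
the corresponding eigenvalue. -/
theorem sum_stdAddChar_mul_transitionMatrix {n : ℕ} [NeZero n] [DecidableEq (ZMod n)]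
    (hn : n ≠ 1) (t : ℝ) (a x : ZMod n) :
    ∑ b, ZMod.stdAddChar (b * x) *
        (transitionMatrix (unitaryCayleyGraph n) t).mulVec (vertexVec a) b =
      Complex.exp (-(Complex.I * t) * unitSum ZMod.stdAddChar x) * ZMod.stdAddChar (a * x) := by
  have h : Matrix.vecMul (fun b => (ZMod.stdAddChar (b * x) : ℂ))
      (transitionMatrix (unitaryCayleyGraph n) t) =
      Complex.exp (-(Complex.I * t) * unitSum ZMod.stdAddChar x) •
        fun b : ZMod n => (ZMod.stdAddChar (b * x) : ℂ) :=
    vecMul_transitionMatrix _ _ (vecMul_adjMatrix_unitaryCayleyGraph hn x)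
  have h2 := Matrix.dotProduct_mulVec (fun b => (ZMod.stdAddChar (b * x) : ℂ))
    (transitionMatrix (unitaryCayleyGraph n) t) (vertexVec a)
  rw [h] at h2
  rw [dotProduct] at h2
  rw [h2]
  simp [vertexVec, dotProduct, Pi.single_apply]

theorem sum_stdAddChar_mul_revival {n : ℕ} [NeZero n] [DecidableEq (ZMod n)] (α β : ℂ)
    (a b x : ZMod n) :
    ∑ c, ZMod.stdAddChar (c * x) * (α • vertexVec a + β • vertexVec b) c =
      α * ZMod.stdAddChar (a * x) + β * ZMod.stdAddChar (b * x) := by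
  simp only [vertexVec, Pi.add_apply, Pi.smul_apply, Pi.single_apply, smul_eq_mul, mul_add,
    Finset.sum_add_distrib, mul_ite, mul_one, mul_zero, Finset.sum_ite_eq', Finset.mem_univ,
    if_true]
  ring

/-- In the limit, the phases of all eigenvalues are prescribed by `α` and `β`. -/
theorem AdmitsPGFRFromTo.tendsto_exp {n : ℕ} [NeZero n] {a b : ZMod n}
    (h : AdmitsPGFRFromTo (unitaryCayleyGraph n) a b) :
    ∃ (t : ℕ → ℝ) (α β : ℂ), β ≠ 0 ∧ ∀ x : ZMod n,
      Filter.Tendsto (fun k => Complex.exp (-(Complex.I * t k) * unitSum ZMod.stdAddChar x))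
        Filter.atTop (nhds (α + β * ZMod.stdAddChar ((b - a) * x))) := by
  obtain ⟨hab, t, α, β, hβ, -, ht⟩ := h
  have hn : n ≠ 1 := by
    rintro rfl
    exact hab (Subsingleton.elim _ _)
  refine ⟨t, α, β, hβ, fun x => ?_⟩
  have h1 := tendsto_finsetSum Finset.univ fun c _ =>
    (tendsto_pi_nhds.1 ht c).const_mul (ZMod.stdAddChar (c * x) : ℂ)
  -- The vertex vectors in `AdmitsPGFRFromTo` are built with classical decidable equality.
  rw [@sum_stdAddChar_mul_revival n _ (fun a b => Classical.propDecidable (a = b))] at h1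
  replace h1 := h1.congr fun k =>
    @sum_stdAddChar_mul_transitionMatrix n _ (fun a b => Classical.propDecidable (a = b)) hn (t k)
      a x
  have h2 := h1.mul_const (ZMod.stdAddChar (-(a * x)) : ℂ)
  have h3 : (ZMod.stdAddChar (a * x) : ℂ) * ZMod.stdAddChar (-(a * x)) = 1 := by
    rw [← AddChar.map_add_eq_mul, add_neg_cancel, AddChar.map_zero_eq_one]
  have h4 : (ZMod.stdAddChar (b * x) : ℂ) * ZMod.stdAddChar (-(a * x)) =
      ZMod.stdAddChar ((b - a) * x) := by
    rw [← AddChar.map_add_eq_mul]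
    congr 1
    ring
  simpa only [mul_assoc, h3, mul_one, add_mul, h4] using h2

/-- Exact fractional revival at a single time `t`, read off from the eigenvalues. -/
theorem admitsPGFR_of_exp_eq {n : ℕ} [NeZero n] (hn : n ≠ 1) (t : ℝ) {α β : ℂ} (hβ : β ≠ 0)
    (hαβ : ‖α‖ ^ 2 + ‖β‖ ^ 2 = 1) {d : ZMod n} (hd : d ≠ 0)
    (h : ∀ x : ZMod n, Complex.exp (-(Complex.I * t) * unitSum ZMod.stdAddChar x) =
      α + β * ZMod.stdAddChar (d * x)) :
    AdmitsPGFR (unitaryCayleyGraph n) := by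
  classical
  refine ⟨0, d, hd.symm, fun _ => t, α, β, hβ, hαβ, ?_⟩
  have heq (inst : DecidableEq (ZMod n)) :
      (transitionMatrix (unitaryCayleyGraph n) t).mulVec (vertexVec 0) =
      α • vertexVec 0 + β • vertexVec d := by
    apply (ZMod.dft (N := n) (E := ℂ)).injective
    funext k
    simp only [ZMod.dft_apply, ← mul_neg, smul_eq_mul]
    rw [sum_stdAddChar_mul_transitionMatrix hn, sum_stdAddChar_mul_revival, h]
    simp
  simp only [heq]
  exact tendsto_const_nhds

end Spectral

/-! ### Eigenvalue relations in `ZMod n` -/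

theorem ZMod.eq_half_of_two_mul_eq_zero {n k : ℕ} [NeZero n] (hn : n = 2 * k)
    {d : ZMod n} (h : 2 * d = 0) (hd : d ≠ 0) : d = (k : ZMod n) := by
  subst hn
  have hv : ((d.val : ℕ) : ZMod (2 * k)) = d := ZMod.natCast_zmod_val d
  have hlt := ZMod.val_lt d
  have h1 : 2 * k ∣ 2 * d.val := by
    rw [← ZMod.natCast_eq_zero_iff]
    push_cast
    rw [hv, h]
  obtain ⟨j, hj⟩ := Nat.dvd_of_mul_dvd_mul_left two_pos h1
  have hj0 : j ≠ 0 := by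
    rintro rfl
    rw [← hv, hj] at hd
    simp at hd
  have hj2 : j < 2 := by
    by_contra hcon
    have : k * 2 ≤ k * j := Nat.mul_le_mul_left k (by omega)
    omega
  have : j = 1 := by omega
  rw [← hv, hj, this, mul_one]

/-- The product relation `unitSum_prod_zero_left`, transported to `ZMod (q * m)`. -/
theorem unitSum_zmod_prime_mul {q m : ℕ} (hq : q.Prime) [NeZero (q * m)] (hqm : q.Coprime m)
    (b : ZMod m) {a : ZMod q} (ha : a ≠ 0) :
    unitSum ZMod.stdAddChar ((ZMod.chineseRemainder hqm).symm (0, b)) =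
      -((q : ℂ) - 1) * unitSum ZMod.stdAddChar ((ZMod.chineseRemainder hqm).symm (a, b)) := by
  have : Fact q.Prime := ⟨hq⟩
  have : NeZero m := ⟨by rintro rfl; exact NeZero.ne (q * 0) (mul_zero q)⟩
  set e := ZMod.chineseRemainder hqm
  rw [← unitSum_ringEquiv _ e, ← unitSum_ringEquiv _ e (e.symm (a, b)), e.apply_symm_apply,
    e.apply_symm_apply]
  rw [unitSum_prod_zero_left _ _ ha, ZMod.card]
  refine ⟨1, fun h => ?_⟩
  have h1 : e.symm (1, 0) = 0 := by
    apply ZMod.injective_stdAddChar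
    simpa using h
  simp at h1

/-- The point `x'` has the same coordinate as `k` away from `q`, so multiplication by an element
`d` of order two does not distinguish them. -/
theorem exists_unitSum_eq_neg_pred_mul {n q : ℕ} [NeZero n] (hq : q.Prime) (hq2 : q ≠ 2)
    (hqn : q ∣ n) (hqq : ¬ q ^ 2 ∣ n) {k : ℕ} (hk : ¬ q ∣ k) :
    ∃ x' : ZMod n, unitSum ZMod.stdAddChar x' =
        -((q : ℂ) - 1) * unitSum ZMod.stdAddChar (k : ZMod n) ∧
      ∀ d : ZMod n, 2 * d = 0 → d * x' = d * k := by
  obtain ⟨m, rfl⟩ := hqn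
  have hqm : q.Coprime m := by
    rw [hq.coprime_iff_not_dvd]
    rintro ⟨r, rfl⟩
    exact hqq ⟨r, by ring⟩
  have : Fact q.Prime := ⟨hq⟩
  have hka : (k : ZMod q) ≠ 0 := by rwa [Ne, ZMod.natCast_eq_zero_iff]
  have hk' : (ZMod.chineseRemainder hqm).symm ((k : ZMod q), (k : ZMod m)) =
      (k : ZMod (q * m)) := by
    rw [RingEquiv.symm_apply_eq, map_natCast]
    rfl
  refine ⟨(ZMod.chineseRemainder hqm).symm (0, (k : ZMod m)), ?_, fun d hd => ?_⟩
  · rw [unitSum_zmod_prime_mul hq hqm _ hka, hk']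
  · rw [← hk']
    apply (ZMod.chineseRemainder hqm).injective
    have hd1 : (ZMod.chineseRemainder hqm d).1 = 0 := by
      have h2 := congrArg (fun y => (ZMod.chineseRemainder hqm y).1) hd
      simp only [map_mul, map_ofNat, map_zero, Prod.fst_mul, Prod.fst_zero] at h2
      have h3 : (2 : ZMod q) ≠ 0 := by
        have : ((2 : ℕ) : ZMod q) ≠ 0 := by
          rw [Ne, ZMod.natCast_eq_zero_iff]
          exact fun h => hq2 ((Nat.prime_dvd_prime_iff_eq hq Nat.prime_two).1 h)
        simpa using this
      exact (mul_eq_zero.1 h2).resolve_left h3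
    rw [map_mul, map_mul, RingEquiv.apply_symm_apply, RingEquiv.apply_symm_apply]
    ext <;> simp [hd1]

/-! ### Necessity -/

/-- An integer relation between two eigenvalues passes to a multiplicative relation between the
limits of their phases. -/
theorem tendsto_exp_mul_pow_eq_one {c : ℕ → ℂ} {l l' f f' : ℂ} (m : ℕ) (h : l' = -(m : ℂ) * l)
    (hf : Filter.Tendsto (fun k => Complex.exp (c k * l)) Filter.atTop (nhds f))
    (hf' : Filter.Tendsto (fun k => Complex.exp (c k * l')) Filter.atTop (nhds f')) :
    f' * f ^ m = 1 := by
  refine tendsto_nhds_unique (hf'.mul (hf.pow m)) ?_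
  convert tendsto_const_nhds using 2 with k
  rw [← Complex.exp_nat_mul, ← Complex.exp_add, h, ← Complex.exp_zero]
  congr 1
  ring

theorem eq_one_of_pow_eq_one_of_coprime {M : Type*} [Monoid M] {z : M} {p q : ℕ}
    (hpq : p.Coprime q) (hp : z ^ p = 1) (hq : z ^ q = 1) : z = 1 := by
  have h := Nat.dvd_gcd (orderOf_dvd_of_pow_eq_one hp) (orderOf_dvd_of_pow_eq_one hq)
  rw [hpq.gcd_eq_one, Nat.dvd_one, orderOf_eq_one_iff] at h
  exact h

theorem eq_two_or_eq_two_mul_prime_of_admitsPGFR {n : ℕ} [NeZero n]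
    (h : AdmitsPGFR (unitaryCayleyGraph n)) : n = 2 ∨ ∃ p : ℕ, p.Prime ∧ n = 2 * p := by
  obtain ⟨a, b, hab⟩ := h
  have hd0 : b - a ≠ 0 := sub_ne_zero.2 hab.1.symm
  obtain ⟨t, α, β, hβ, hf⟩ := hab.tendsto_exp
  generalize b - a = d at hd0 hf
  -- `x` and `-x` have the same eigenvalue, which forces `d` to have order two.
  have hd2 : 2 * d = 0 := by
    have h1 := hf (-1)
    rw [unitSum_neg] at h1
    have h2 := tendsto_nhds_unique h1 (hf 1)
    have h3 := ZMod.injective_stdAddChar (mul_left_cancel₀ hβ (add_left_cancel h2))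
    linear_combination -h3
  have hψd : (ZMod.stdAddChar d : ℂ) = -1 := by
    have h1 : (ZMod.stdAddChar d : ℂ) * ZMod.stdAddChar d = 1 := by
      rw [← AddChar.map_add_eq_mul, ← two_mul, hd2, AddChar.map_zero_eq_one]
    refine (mul_self_eq_one_iff.1 h1).resolve_left fun h2 => hd0 ?_
    apply ZMod.injective_stdAddChar
    rw [h2, AddChar.map_zero_eq_one]
  have hne : α + β * ZMod.stdAddChar (d * 1) ≠ α + β * ZMod.stdAddChar (d * 2) := by
    rw [mul_one, mul_comm d 2, hd2, hψd, AddChar.map_zero_eq_one]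
    intro h1
    have h2 : 2 * β = 0 := by linear_combination -h1
    exact hβ ((mul_eq_zero.1 h2).resolve_left two_ne_zero)
  have hzero : ∀ x : ZMod n, unitSum ZMod.stdAddChar x = 0 →
      α + β * ZMod.stdAddChar (d * x) = 1 := by
    intro x hx
    simpa using tendsto_exp_mul_pow_eq_one 0 (by simpa using hx) (hf x) (hf x)
  -- If the class of `s` is nilpotent and `2 * s ≠ 0` in `ZMod n`, then the eigenvalues at `1` and
  -- `2` both vanish.
  have hnil : ∀ s : ℕ, n ∣ s ^ 3 → n ∣ 2 * s := by
    intro s hs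
    by_contra h2s
    have hs' : IsNilpotent (s : ZMod n) :=
      ⟨3, by exact_mod_cast (ZMod.natCast_eq_zero_iff (s ^ 3) n).2 hs⟩
    have hψ : ∀ y : ZMod n, y ≠ 0 → (ZMod.stdAddChar y : ℂ) ≠ 1 := by
      intro y hy h1
      apply hy
      apply ZMod.injective_stdAddChar
      rw [h1, AddChar.map_zero_eq_one]
    have h2 : (s : ZMod n) * 2 ≠ 0 := by
      rw [mul_comm]
      exact_mod_cast fun h => h2s ((ZMod.natCast_eq_zero_iff (2 * s) n).1 h)
    have h1 : (s : ZMod n) * 1 ≠ 0 := by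
      intro h
      rw [mul_one] at h
      rw [h, zero_mul] at h2
      exact h2 rfl
    exact hne ((hzero 1 (unitSum_eq_zero_of_isNilpotent _ hs' (hψ _ h1))).trans
      (hzero 2 (unitSum_eq_zero_of_isNilpotent _ hs' (hψ _ h2))).symm)
  have hn0 : 0 < n := Nat.pos_of_ne_zero (NeZero.ne n)
  have hsq : ∀ q : ℕ, q.Prime → q ≠ 2 → ¬ q ^ 2 ∣ n := by
    rintro q hq hq2 ⟨r, hr⟩
    have hr0 : 0 < q * r := Nat.pos_of_ne_zero (by rintro h; rw [sq, mul_assoc, h] at hr; omega)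
    -- For `n = q ^ 2 * r` the nilpotent element is `n / q`.
    have h1 := hnil (q * r) ⟨q * r ^ 2, by rw [hr]; ring⟩
    rw [hr, sq, mul_assoc] at h1
    exact hq2 ((Nat.prime_dvd_prime_iff_eq hq Nat.prime_two).1
      (Nat.dvd_of_mul_dvd_mul_right hr0 h1))
  have height : ¬ 8 ∣ n := by
    rintro ⟨r, hr⟩
    -- For `n = 8 * r` the nilpotent element is `n / 4`.
    have h1 := Nat.le_of_dvd (by omega) (hnil (2 * r) ⟨r ^ 2, by rw [hr]; ring⟩)
    omega
  have hodd : ∀ q : ℕ, q.Prime → q ≠ 2 → q ∣ n → ∀ k : ℕ, ¬ q ∣ k →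
      (α + β * ZMod.stdAddChar (d * (k : ZMod n))) ^ q = 1 := by
    intro q hq hq2 hqn k hk
    obtain ⟨x', hx', hdx⟩ := exists_unitSum_eq_neg_pred_mul hq hq2 hqn (hsq q hq hq2) hk
    have h1 := tendsto_exp_mul_pow_eq_one (q - 1)
      (by rw [hx', Nat.cast_sub hq.one_le, Nat.cast_one]) (hf k) (hf x')
    rwa [hdx d hd2, ← pow_succ', Nat.sub_add_cancel hq.one_le] at h1
  have hodd1 : ∀ q : ℕ, q.Prime → q ≠ 2 → q ∣ n →
      (α + β * ZMod.stdAddChar (d * 1)) ^ q = 1 := fun q hq hq2 hqn => by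
    simpa using hodd q hq hq2 hqn 1 hq.not_dvd_one
  have hodd2 : ∀ q : ℕ, q.Prime → q ≠ 2 → q ∣ n →
      (α + β * ZMod.stdAddChar (d * 2)) ^ q = 1 := fun q hq hq2 hqn => by
    simpa using hodd q hq hq2 hqn 2
      fun h => hq2 ((Nat.prime_dvd_prime_iff_eq hq Nat.prime_two).1 h)
  have heven : 2 ∣ n := by
    by_contra h2
    have hu : IsUnit ((2 : ℕ) : ZMod n) := (ZMod.isUnit_iff_coprime 2 n).2
      ((Nat.prime_two.coprime_iff_not_dvd).2 h2)
    exact hd0 ((hu.mul_right_eq_zero).1 (by exact_mod_cast hd2))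
  have hfour : 4 ∣ n → ∀ x : ZMod n, (α + β * ZMod.stdAddChar (d * x)) ^ 2 = 1 := by
    rintro ⟨r, hr⟩ x
    have hr' : n = 2 * (2 * r) := by omega
    have hdd : d * d = 0 := by
      rw [ZMod.eq_half_of_two_mul_eq_zero hr' hd2 hd0]
      exact_mod_cast (ZMod.natCast_eq_zero_iff (2 * r * (2 * r)) n).2 ⟨r, by rw [hr]; ring⟩
    have hshift : unitSum ZMod.stdAddChar (x + d) = -((1 : ℕ) : ℂ) * unitSum ZMod.stdAddChar x := by
      refine unitSum_add_of_forall_unit _ _ (fun c hc => ?_) x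
      have hcd : c * d = d := by
        rw [ZMod.eq_half_of_two_mul_eq_zero hr' (by rw [mul_left_comm, hd2, mul_zero])
          (mt (hc.mul_right_eq_zero).1 hd0), ← ZMod.eq_half_of_two_mul_eq_zero hr' hd2 hd0]
      rw [hcd, hψd, Nat.cast_one]
    have h1 := tendsto_exp_mul_pow_eq_one 1 hshift (hf x) (hf (x + d))
    rw [mul_add, hdd, add_zero, pow_one] at h1
    rw [sq, h1]
  have hcop : ∀ p q : ℕ, p.Coprime q →
      (α + β * ZMod.stdAddChar (d * 1)) ^ p = 1 → (α + β * ZMod.stdAddChar (d * 2)) ^ p = 1 →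
      (α + β * ZMod.stdAddChar (d * 1)) ^ q = 1 → (α + β * ZMod.stdAddChar (d * 2)) ^ q = 1 →
      False := fun p q hpq h1 h2 h3 h4 => hne
    ((eq_one_of_pow_eq_one_of_coprime hpq h1 h3).trans
      (eq_one_of_pow_eq_one_of_coprime hpq h2 h4).symm)
  have hfourodd : ∀ q : ℕ, q.Prime → q ≠ 2 → q ∣ n → ¬ 4 ∣ n := fun q hq hq2 hqn h4 =>
    hcop 2 q ((Nat.coprime_primes Nat.prime_two hq).2 hq2.symm) (hfour h4 1) (hfour h4 2)
      (hodd1 q hq hq2 hqn) (hodd2 q hq hq2 hqn)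
  obtain ⟨k, hk⟩ := heven
  by_cases hk1 : k = 1
  · exact Or.inl (by rw [hk, hk1])
  refine Or.inr ⟨k, ?_, hk⟩
  -- Otherwise `k` is divisible by a product `p * q` of two primes, each case being excluded.
  by_contra hkp
  obtain ⟨r, hr⟩ := Nat.minFac_dvd k
  have hp := Nat.minFac_prime hk1
  set p := k.minFac
  have hr1 : r ≠ 1 := by
    rintro rfl
    rw [mul_one] at hr
    exact hkp (hr ▸ hp)
  obtain ⟨s, hs⟩ := Nat.minFac_dvd r
  have hq := Nat.minFac_prime hr1
  set q := r.minFac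
  have hn : n = 2 * (p * (q * s)) := by rw [hk, hr, hs]
  have hpn : p ∣ n := ⟨2 * (q * s), by rw [hn]; ring⟩
  have hqn : q ∣ n := ⟨2 * (p * s), by rw [hn]; ring⟩
  by_cases hp2 : p = 2
  · rw [hp2] at hn
    by_cases hq2 : q = 2
    · exact height ⟨s, by rw [hn, hq2]; ring⟩
    · exact hfourodd q hq hq2 hqn ⟨q * s, by rw [hn]; ring⟩
  · by_cases hq2 : q = 2
    · exact hfourodd p hp hp2 hpn ⟨p * s, by rw [hn, hq2]; ring⟩
    · by_cases hpq : p = q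
      · exact hsq p hp hp2 ⟨2 * s, by rw [hn, ← hpq]; ring⟩
      · exact hcop p q ((Nat.coprime_primes hp hq).2 hpq) (hodd1 p hp hp2 hpn)
          (hodd2 p hp hp2 hpn) (hodd1 q hq hq2 hqn) (hodd2 q hq hq2 hqn)

/-! ### Sufficiency -/

theorem unitSum_zero {R : Type*} [CommRing R] [Fintype R] (ψ : AddChar R ℂ) :
    unitSum ψ 0 = Nat.card Rˣ := by
  classical
  rw [Nat.card_congr (Equiv.ofInjective _ Units.val_injective), Nat.card_eq_fintype_card,
    Fintype.card_subtype]
  simp only [unitSum, mul_zero, AddChar.map_zero_eq_one, Finset.sum_boole]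
  rfl

theorem admitsPGFR_unitaryCayleyGraph_two : AdmitsPGFR (unitaryCayleyGraph 2) := by
  refine admitsPGFR_of_exp_eq (α := 0) (β := -Complex.I) (d := 1) (by norm_num) (Real.pi / 2)
    (by simp) (by simp) (by decide) fun x => ?_
  have hu : unitSum ZMod.stdAddChar x = ZMod.stdAddChar x := by
    have h0 : ¬ IsUnit (0 : ZMod 2) := by simp
    have h1 : IsUnit (1 : ZMod 2) := isUnit_one
    have : (Finset.univ : Finset (ZMod 2)) = {0, 1} := rfl
    simp only [unitSum, this]
    rw [Finset.sum_pair (by decide), if_neg h0, if_pos h1, zero_add, one_mul]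
  have hx : x + x = 0 := by clear hu; revert x; decide
  have hsq : (ZMod.stdAddChar x : ℂ) * ZMod.stdAddChar x = 1 := by
    rw [← AddChar.map_add_eq_mul, hx, AddChar.map_zero_eq_one]
  rw [hu, one_mul]
  push_cast
  rcases mul_self_eq_one_iff.1 hsq with h | h <;> rw [h]
  · rw [show -(Complex.I * (Real.pi / 2)) * 1 = -(Real.pi / 2 * Complex.I) by ring,
      Complex.exp_neg, Complex.exp_pi_div_two_mul_I]
    simp
  · rw [show -(Complex.I * (Real.pi / 2)) * -1 = Real.pi / 2 * Complex.I by ring,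
      Complex.exp_pi_div_two_mul_I]
    simp

theorem admitsPGFR_unitaryCayleyGraph_four : AdmitsPGFR (unitaryCayleyGraph 4) := by
  refine admitsPGFR_of_exp_eq (α := 0) (β := -1) (d := 2) (by norm_num) (Real.pi / 2)
    (by simp) (by simp) (by decide) fun x => ?_
  have hu : unitSum ZMod.stdAddChar x = ZMod.stdAddChar x + ZMod.stdAddChar x ^ 3 := by
    have h0 : ¬ IsUnit (0 : ZMod 4) := by decide
    have h1 : IsUnit (1 : ZMod 4) := isUnit_one
    have h2 : ¬ IsUnit (2 : ZMod 4) := by decide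
    have h3 : IsUnit (3 : ZMod 4) := by decide
    have : (Finset.univ : Finset (ZMod 4)) = {0, 1, 2, 3} := rfl
    simp only [unitSum, this]
    rw [Finset.sum_insert (by decide), Finset.sum_insert (by decide), Finset.sum_pair (by decide),
      if_neg h0, if_pos h1, if_neg h2, if_pos h3, zero_add, zero_add, one_mul,
      ← AddChar.map_nsmul_eq_pow]
    congr 2
    simp
  have hx : 4 • x = 0 := by clear hu; revert x; decide
  have h4 : (ZMod.stdAddChar x : ℂ) ^ 4 = 1 := by
    rw [← AddChar.map_nsmul_eq_pow, hx, AddChar.map_zero_eq_one]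
  have h2 : (ZMod.stdAddChar (2 * x) : ℂ) = ZMod.stdAddChar x ^ 2 := by
    rw [← AddChar.map_nsmul_eq_pow]
    congr 1
    simp
  rw [hu, h2]
  generalize (ZMod.stdAddChar x : ℂ) = z at h4
  push_cast
  have hz : (z ^ 2 - 1) * (z ^ 2 + 1) = 0 := by linear_combination h4
  rcases mul_eq_zero.1 hz with h | h
  · have hz2 : z ^ 2 = 1 := by linear_combination h
    rw [show z + z ^ 3 = 2 * z by linear_combination z * hz2, hz2]
    rcases sq_eq_one_iff.1 hz2 with rfl | rfl
    · rw [show -(Complex.I * (Real.pi / 2)) * (2 * 1) = -(Real.pi * Complex.I) by ring,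
        Complex.exp_neg, Complex.exp_pi_mul_I]
      norm_num
    · rw [show -(Complex.I * (Real.pi / 2)) * (2 * -1) = Real.pi * Complex.I by ring,
        Complex.exp_pi_mul_I]
      norm_num
  · rw [show z + z ^ 3 = 0 by linear_combination z * h,
      show z ^ 2 = -1 by linear_combination h]
    simp

/-- For an odd prime `p` every eigenvalue is `-z` or `(p - 1) * z` with `z = ±1` the value at `x`
of the character attached to the element of order two. At time `2 * π / p` both give the same
phase. -/
theorem admitsPGFR_unitaryCayleyGraph_of_eq_prime_mul_two {n p : ℕ} [NeZero n]
    (hp : p.Prime) (hp2 : p ≠ 2) (hn : n = p * 2) : AdmitsPGFR (unitaryCayleyGraph n) := by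
  subst hn
  have : Fact p.Prime := ⟨hp⟩
  have hcop : p.Coprime 2 := (Nat.coprime_primes hp Nat.prime_two).2 hp2
  have hp3 : 3 ≤ p := by have := hp.two_le; omega
  have hpR : (3 : ℝ) ≤ p := by exact_mod_cast hp3
  have hpC : (p : ℂ) ≠ 0 := by exact_mod_cast hp.ne_zero
  set e := ZMod.chineseRemainder hcop with he
  have hsin : 0 < Real.sin (2 * Real.pi / p) := by
    apply Real.sin_pos_of_pos_of_lt_pi
    · positivity
    · rw [div_lt_iff₀ (by linarith)]
      nlinarith [Real.pi_pos]
  refine admitsPGFR_of_exp_eq (α := Real.cos (2 * Real.pi / p))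
    (β := Complex.I * Real.sin (2 * Real.pi / p)) (d := e.symm (0, 1)) (by omega)
    (2 * Real.pi / p) ?_ ?_ ?_ fun x => ?_
  · exact mul_ne_zero Complex.I_ne_zero (by exact_mod_cast hsin.ne')
  · rw [norm_mul, Complex.norm_I, one_mul, Complex.norm_real, Complex.norm_real, Real.norm_eq_abs,
      Real.norm_eq_abs, sq_abs, sq_abs, Real.cos_sq_add_sin_sq]
  · simp
  obtain ⟨⟨a, b⟩, rfl⟩ := e.symm.surjective x
  have hdx : e.symm (0, 1) * e.symm (a, b) = e.symm (0, b) := by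
    rw [← map_mul]
    simp
  have hsplit : e.symm (a, b) = e.symm (a, 0) + e.symm (0, b) := by
    rw [← map_add]
    simp
  -- The only unit of `ZMod 2` is `1`, so all units fix the second summand.
  have hshift : unitSum ZMod.stdAddChar (e.symm (a, b)) =
      ZMod.stdAddChar (e.symm (0, b)) * unitSum ZMod.stdAddChar (e.symm (a, 0)) := by
    rw [hsplit]
    refine unitSum_add_of_forall_unit _ _ (fun c hc => ?_) _
    congr 1
    rw [RingEquiv.eq_symm_apply, map_mul, RingEquiv.apply_symm_apply]
    have h1 : IsUnit (e c).2 := (Prod.isUnit_iff.1 (hc.map e)).2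
    have h2 : ∀ y : ZMod 2, y ≠ 0 → y = 1 := by decide
    ext
    · simp
    · simp [h2 _ h1.ne_zero]
  have h00 : unitSum ZMod.stdAddChar (e.symm (0, 0)) = (p : ℂ) - 1 := by
    rw [show ((0, 0) : ZMod p × ZMod 2) = 0 from rfl, map_zero, unitSum_zero,
      Nat.card_eq_fintype_card, ZMod.card_units_eq_totient, Nat.totient_mul hcop,
      Nat.totient_two, mul_one, Nat.totient_prime hp, Nat.cast_sub hp.one_le, Nat.cast_one]
  have hz : (ZMod.stdAddChar (e.symm (0, b)) : ℂ) * ZMod.stdAddChar (e.symm (0, b)) = 1 := by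
    have hb : b + b = 0 := by clear hdx hsplit hshift; revert b; decide
    rw [← AddChar.map_add_eq_mul, ← map_add, Prod.mk_add_mk, hb, add_zero, Prod.mk_zero_zero,
      map_zero, AddChar.map_zero_eq_one]
  rw [hdx, hshift]
  generalize (ZMod.stdAddChar (e.symm (0, b)) : ℂ) = z at hz
  have hphase : Complex.exp (2 * Real.pi / p * z * Complex.I) =
      Real.cos (2 * Real.pi / p) + Complex.I * Real.sin (2 * Real.pi / p) * z := by
    push_cast
    rw [Complex.exp_mul_I]
    rcases mul_self_eq_one_iff.1 hz with rfl | rfl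
    · rw [mul_one, mul_one, mul_comm Complex.I]
    · rw [mul_neg_one, Complex.cos_neg, Complex.sin_neg]
      ring
  rw [← hphase]
  by_cases ha : a = 0
  · rw [ha, h00]
    have hperiod : Complex.exp (-(2 * Real.pi * z * Complex.I)) = 1 := by
      rcases mul_self_eq_one_iff.1 hz with rfl | rfl
      · rw [mul_one, Complex.exp_neg, Complex.exp_two_pi_mul_I, inv_one]
      · rw [mul_neg_one, neg_mul, neg_neg, Complex.exp_two_pi_mul_I]
    have hexp : -(Complex.I * ((2 * Real.pi / p : ℝ) : ℂ)) * (z * ((p : ℂ) - 1)) =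
        2 * Real.pi / p * z * Complex.I + -(2 * Real.pi * z * Complex.I) := by
      push_cast
      field_simp
      ring
    rw [hexp, Complex.exp_add, hperiod, mul_one]
  · have h0 := unitSum_zmod_prime_mul hp hcop 0 ha
    rw [← he, h00] at h0
    have hp1 : (p : ℂ) - 1 ≠ 0 := by
      rw [sub_ne_zero]
      exact_mod_cast hp.one_lt.ne'
    have h1 : unitSum ZMod.stdAddChar (e.symm (a, 0)) = -1 :=
      mul_left_cancel₀ hp1 (by linear_combination h0)
    rw [h1]
    congr 1
    push_cast
    ring

theorem mainTheorem1 (n : ℕ) [NeZero n] :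
    AdmitsPGFR (unitaryCayleyGraph n) ↔ (n = 2 ∨ ∃ p : ℕ, p.Prime ∧ n = 2 * p) := by
  refine ⟨eq_two_or_eq_two_mul_prime_of_admitsPGFR, ?_⟩
  rintro (rfl | ⟨p, hp, rfl⟩)
  · exact admitsPGFR_unitaryCayleyGraph_two
  · by_cases hp2 : p = 2
    · subst hp2
      exact admitsPGFR_unitaryCayleyGraph_four
    · exact admitsPGFR_unitaryCayleyGraph_of_eq_prime_mul_two hp hp2 (mul_comm 2 p)
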